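/- Let $P$ be a probability measure and consider, for $t\ge 0$, the linear (time-varying) Gaussian system $$\dot X_t = A(t)X_t + B(t)W_t,\qquad Z_t = C(t)X_t + N_t,\qquad X_0\sim\mathcal N(\mu_0,P_0),\ P_0\succ 0,$$ with state $X_t\in\mathbb R^{n_X}$ (with almost surely continuous sample paths) and measurement $Z_t\in\mathbb R^{n_Z}$. The entries of $A$ are locally integrable and those of $B$ and $C$ are locally square-integrable on $[0,\infty)$. Here $W$ and $N$ are zero-mean Gaussian white noises in $\mathbb R^{n_W}$ and $\mathbb R^{n_Z}$ with $\mathbb E[W_tW_s']=\Sigma_W\delta(t-s)$, $\mathbb E[N_tN_s']=\Sigma_N\delta(t-s)$, $\Sigma_W,\Sigma_N\succ0$; $W$ is independent of $X_0$, and $N$ is independent of $(X_0,W)$. White noise and the measurement are generalized processes, i.e. they are given by the random variables $W(f)=\int f(t)'W_t\,dt$, $N(\varphi)=\int \varphi(t)'N_t\,dt$ and $Z(\varphi)=\int\varphi(t)'C(t)X_t\,dt+N(\varphi)$ for square-integrable test functions of bounded support in $[0,\infty)$, and the state equation holds in integrated form. For $\tau\ge 0$ let $\mathcal Z_{[0,\tau]}$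 be the measurement history over $[0,\tau]$, i.e. the family of all $Z(\varphi)$ with $\varphi$ vanishing outside $[0,\tau]$. Let $\mathcal I(Y_1;Y_2)\in[0,\infty]$ denote the mutual information, i.e. the Kullback–Leibler divergence of the joint law of $(Y_1,Y_2)$ from the product of the marginal laws (path spaces carry the product $\sigma$-algebra). Let $0\le\tau\le T_i\le T_f$, let $V_t=M_V(t)X_t$ be the verification variables, $\mathcal V_{[T_i,T_f]}=\{V_t: t\in[T_i,T_f]\}$, $\mathcal X_{[T_i,T_f]}=\{X_t: t\in[T_i,T_f]\}$. If the whole state is verified, i.e. $M_V(t)=I_{n_X}$ for $t\in[T_i,T_f]$, then $$\mathcal I(\mathcal V_{[T_i,T_f]};\mathcal Z_{[0,\tau]})=\mathcal I(V_{T_i};\mathcal Z_{[0,\tau]}),\qquad\text{that is,}\qquad \mathcal I(\mathcal X_{[T_i,T_f]};\mathcal Z_{[0,\tau]})=\mathcal I(X_{T_i};\mathcal Z_{[0,\tau]}).$$ -/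

import Mathlib

open MeasureTheory ProbabilityTheory Set
open scoped ENNReal Matrix

noncomputable section

namespace LinearForecast

/-- The mutual information `I(Y₁; Y₂) ∈ [0, ∞]` of two random quantities: the Kullback-Leibler
divergence of their joint law from the product of their marginal laws. -/
def mutualInfo {Ω S₁ S₂ : Type*} [MeasurableSpace Ω] [MeasurableSpace S₁] [MeasurableSpace S₂]
    (P : Measure Ω) (Y₁ : Ω → S₁) (Y₂ : Ω → S₂) : ℝ≥0∞ :=
  InformationTheory.klDiv (P.map (fun ω => (Y₁ ω, Y₂ ω))) ((P.map Y₁).prod (P.map Y₂))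

/-- Test functions: square-integrable functions `[0, ∞) → ℝⁿ` of bounded support (extended by zero
to negative times). -/
def TestFun (n : ℕ) : Type :=
  {f : ℝ → Fin n → ℝ // MemLp f 2 volume ∧ ∃ T : ℝ, ∀ t, t ∉ Icc 0 T → f t = 0}

/-- `W` is a zero-mean Gaussian white noise in `ℝⁿ` with `E[W_t W_s'] = S δ(t - s)`. As usual, white
noise is a generalized process: `W f` stands for `∫ f(t)' W_t dt`, and the covariance formula reads
`E[(W f) (W g)] = ∫ f(t)' S g(t) dt`. -/
structure IsWhiteNoise {Ω : Type*} [MeasurableSpace Ω] (P : Measure Ω) {n : ℕ}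
    (S : Matrix (Fin n) (Fin n) ℝ) (W : TestFun n → Ω → ℝ) : Prop where
  measurable : ∀ f, Measurable (W f)
  gaussian : IsGaussianProcess W P
  mean_zero : ∀ f, ∫ ω, W f ω ∂P = 0
  covariance : ∀ f g, ∫ ω, W f ω * W g ω ∂P = ∫ t, f.1 t ⬝ᵥ (S *ᵥ g.1 t)

/-- All entries of `M` are square-integrable on bounded time intervals `[0, T]`. -/
def LocallySqIntegrable {m n : ℕ} (M : ℝ → Matrix (Fin m) (Fin n) ℝ) : Prop :=
  ∀ i j (T : ℝ), MemLp (fun t => M t i j) 2 (volume.restrict (Icc 0 T))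

/-- The test function `s ↦ 1_{[0,t]}(s) Bᵢ(s)`, where `Bᵢ` is the `i`-th row of `B`. Hence, for a
white noise `W`, the random variable `W (rowUpTo B hB i t)` is the `i`-th component of
`∫₀ᵗ B(s) W_s ds`. -/
def rowUpTo {m n : ℕ} (B : ℝ → Matrix (Fin m) (Fin n) ℝ) (hB : LocallySqIntegrable B)
    (i : Fin m) (t : ℝ) : TestFun n :=
  ⟨(Icc 0 t).indicator (fun s => B s i), by
    refine ⟨?_, t, fun s hs => indicator_of_notMem hs _⟩
    rw [memLp_indicator_iff_restrict measurableSet_Icc]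
    exact MemLp.of_eval fun j => hB i j t⟩

/-- The linear Gaussian model on the time axis `[0, ∞)`
`dX_t/dt = A(t) X_t + B(t) W_t`, `X_0 ∼ N(μ₀, P₀)`, `Z_t = C(t) X_t + N_t`,
where `W`, `N` are zero-mean Gaussian white noises with intensities `SW`, `SN`, and `X_0`, `W`, `N`
are independent. The state equation is understood in its integrated form, and the measurement, like
the noise `N`, is a generalized process: `Z φ` stands for `∫ φ(t)' Z_t dt`. -/
structure IsLinearGaussianModel {Ω : Type*} [MeasurableSpace Ω] (P : Measure Ω) {nX nW nZ : ℕ}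
    (A : ℝ → Matrix (Fin nX) (Fin nX) ℝ)
    (B : ℝ → Matrix (Fin nX) (Fin nW) ℝ) (hB : LocallySqIntegrable B)
    (C : ℝ → Matrix (Fin nZ) (Fin nX) ℝ)
    (SW : Matrix (Fin nW) (Fin nW) ℝ) (SN : Matrix (Fin nZ) (Fin nZ) ℝ)
    (μ₀ : EuclideanSpace ℝ (Fin nX)) (P₀ : Matrix (Fin nX) (Fin nX) ℝ)
    (W : TestFun nW → Ω → ℝ) (N : TestFun nZ → Ω → ℝ)
    (X : ℝ → Ω → Fin nX → ℝ) (Z : TestFun nZ → Ω → ℝ) : Prop where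
  whiteNoise_W : IsWhiteNoise P SW W
  whiteNoise_N : IsWhiteNoise P SN N
  measurable_X : ∀ t, 0 ≤ t → Measurable (X t)
  measurable_Z : ∀ φ, Measurable (Z φ)
  law_X_zero : HasLaw (fun ω => WithLp.toLp 2 (X 0 ω)) (multivariateGaussian μ₀ P₀) P
  indep_W : IndepFun (X 0) (fun ω f => W f ω) P
  indep_N : IndepFun (fun ω => (X 0 ω, fun f => W f ω)) (fun ω g => N g ω) P
  continuous_X : ∀ᵐ ω ∂P, ContinuousOn (fun t => X t ω) (Ici 0)
  state_eq : ∀ t, 0 ≤ t → ∀ᵐ ω ∂P, ∀ i,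
    X t ω i = X 0 ω i + (∫ s in (0 : ℝ)..t, (A s *ᵥ X s ω) i) + W (rowUpTo B hB i t) ω
  measurement_eq : ∀ φ, ∀ᵐ ω ∂P, Z φ ω = (∫ t, φ.1 t ⬝ᵥ (C t *ᵥ X t ω)) + N φ ω

/-- The restriction `{Y_t : t ∈ [t₁, t₂]}` of a process to a time window, as a random path with the
product σ-algebra. -/
def pathOn {Ω E : Type*} (Y : ℝ → Ω → E) (t₁ t₂ : ℝ) : Ω → Icc t₁ t₂ → E :=
  fun ω t => Y t ω

/-- The history `{Z_t : t ∈ [t₁, t₂]}` of a generalized process: its values on all test functions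
that vanish outside `[t₁, t₂]`. -/
def historyOn {Ω : Type*} {n : ℕ} (Z : TestFun n → Ω → ℝ) (t₁ t₂ : ℝ) :
    Ω → {φ : TestFun n // ∀ t, t ∉ Icc t₁ t₂ → φ.1 t = 0} → ℝ :=
  fun ω φ => Z φ.1 ω

/-- The verification variables `V_t = M_V(t) X_t`. -/
def verification {Ω : Type*} {nV nX : ℕ} (MV : ℝ → Matrix (Fin nV) (Fin nX) ℝ)
    (X : ℝ → Ω → Fin nX → ℝ) : ℝ → Ω → Fin nV → ℝ :=
  fun t ω => MV t *ᵥ X t ω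

end LinearForecast

end

/-! The state is Markov. Let `U` be the family of noise increments after `T = Ti`. On the window, `X
t` is almost surely a function of `X T` and `U`, and `U` is independent of `X T` jointly with the
measurement history `Z`. Hence `I(path; Z) ≤ I((X T, U); Z) ≤ I(X T; Z)`, by data processing and
then by discarding the independent `U`. The reverse inequality is data processing, since `X T` is a
coordinate of the path.

The functional dependence comes from solving the integrated state equation by Picard iteration
(`aestronglyMeasurable_of_volterra`). Used on `[0, T]`, the same result makes `X T` and `Z`
functions of `X 0`, the past of `W`, and `N`; joint Gaussianity and zero covariance make the later
increments independent of that past (`indepFun_state_history_increments`).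

These identities hold off null sets that depend on the time or test function, and there are
uncountably many of those. Product σ-algebras and completion by null sets absorb this. -/

namespace LinearForecast

/-! ### Mutual information: modifications, data processing, independent adjunction -/

section MutualInformation

variable {Ω : Type*} {mΩ : MeasurableSpace Ω} {P : Measure Ω}

/-- Modifications of a process cannot be distinguished by the product σ-algebra, up to null sets. -/
theorem preimage_ae_eq_of_forall_ae_eq {ι : Type*} {E : ι → Type*} [∀ i, MeasurableSpace (E i)]
    {f g : Ω → ∀ i, E i} (h : ∀ i, (fun ω => f ω i) =ᵐ[P] fun ω => g ω i)
    {s : Set (∀ i, E i)} (hs : MeasurableSet s) : f ⁻¹' s =ᵐ[P] g ⁻¹' s := by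
  -- The index set may be uncountable, so `f = g` almost everywhere can fail. The sets with almost
  -- equal preimages still form a σ-algebra, and it contains the cylinders.
  let m : MeasurableSpace (∀ i, E i) :=
    { MeasurableSet' := fun s => f ⁻¹' s =ᵐ[P] g ⁻¹' s
      measurableSet_empty := by simp
      measurableSet_compl := fun s hs => by
        rw [preimage_compl, preimage_compl]
        exact hs.compl
      measurableSet_iUnion := fun s hs => by
        rw [preimage_iUnion, preimage_iUnion]
        exact Filter.EventuallyEq.countable_iUnion hs }
  have hm : MeasurableSpace.pi ≤ m := by
    refine iSup_le fun i => ?_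
    rintro _ ⟨u, -, rfl⟩
    exact (h i).preimage u
  exact hm s hs

theorem map_prodMk_eq_of_forall_ae_eq [IsFiniteMeasure P] {ι : Type*} {E : ι → Type*}
    [∀ i, MeasurableSpace (E i)] {S : Type*} [MeasurableSpace S]
    {f g : Ω → ∀ i, E i} {k : Ω → S} (hf : Measurable f) (hg : Measurable g) (hk : Measurable k)
    (h : ∀ i, (fun ω => f ω i) =ᵐ[P] fun ω => g ω i) :
    P.map (fun ω => (f ω, k ω)) = P.map (fun ω => (g ω, k ω)) := by
  refine Measure.ext_prod fun {s t} hs ht => ?_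
  rw [Measure.map_apply (hf.prodMk hk) (hs.prod ht), Measure.map_apply (hg.prodMk hk) (hs.prod ht),
    mk_preimage_prod, mk_preimage_prod]
  exact measure_congr ((preimage_ae_eq_of_forall_ae_eq h hs).inter (Filter.EventuallyEq.refl _ _))

theorem mutualInfo_congr_of_forall_ae_eq [IsFiniteMeasure P] {ι : Type*} {E : ι → Type*}
    [∀ i, MeasurableSpace (E i)] {S : Type*} [MeasurableSpace S]
    {f g : Ω → ∀ i, E i} {k : Ω → S} (hf : Measurable f) (hg : Measurable g) (hk : Measurable k)
    (h : ∀ i, (fun ω => f ω i) =ᵐ[P] fun ω => g ω i) :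
    mutualInfo P f k = mutualInfo P g k := by
  have hfg := map_prodMk_eq_of_forall_ae_eq hf hg hk h
  have h₁ : P.map f = P.map g := by
    simpa [Measure.map_map measurable_fst, hf.prodMk hk, hg.prodMk hk, Function.comp_def]
      using congrArg (Measure.map Prod.fst) hfg
  rw [mutualInfo, mutualInfo, hfg, h₁]

/-- Data processing inequality for the mutual information. -/
theorem mutualInfo_comp_left_le [IsFiniteMeasure P] {S₁ S₂ S₃ : Type*} [MeasurableSpace S₁]
    [MeasurableSpace S₂] [MeasurableSpace S₃] {Y : Ω → S₁} {Z : Ω → S₂} {g : S₁ → S₃}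
    (hY : Measurable Y) (hZ : Measurable Z) (hg : Measurable g) :
    mutualInfo P (fun ω => g (Y ω)) Z ≤ mutualInfo P Y Z := by
  have h := InformationTheory.klDiv_map_le (μ := P.map fun ω => (Y ω, Z ω))
    (ν := (P.map Y).prod (P.map Z)) (hg.prodMap measurable_id)
  rwa [Measure.map_map (hg.prodMap measurable_id) (hY.prodMk hZ),
    ← Measure.map_prod_map _ _ hg measurable_id, Measure.map_map hg hY, Measure.map_id] at h

/-- Adjoining an independent variable does not increase the mutual information. -/
theorem mutualInfo_prodMk_le_of_indepFun [IsProbabilityMeasure P] {S₁ S₂ S₃ : Type*}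
    [MeasurableSpace S₁] [MeasurableSpace S₂] [MeasurableSpace S₃]
    {Y : Ω → S₁} {Z : Ω → S₂} {U : Ω → S₃}
    (hY : Measurable Y) (hZ : Measurable Z) (hU : Measurable U)
    (h : IndepFun (fun ω => (Y ω, Z ω)) U P) :
    mutualInfo P (fun ω => (Y ω, U ω)) Z ≤ mutualInfo P Y Z := by
  have hYU : IndepFun Y U P := h.comp measurable_fst measurable_id
  have := Measure.isProbabilityMeasure_map (μ := P) hY.aemeasurable
  have := Measure.isProbabilityMeasure_map (μ := P) hZ.aemeasurable
  have := Measure.isProbabilityMeasure_map (μ := P) hU.aemeasurable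
  have := Measure.isProbabilityMeasure_map (μ := P) (hY.prodMk hZ).aemeasurable
  let e : (S₁ × S₂) × S₃ → (S₁ × S₃) × S₂ := fun x => ((x.1.1, x.2), x.1.2)
  have he : Measurable e := by fun_prop
  have e₁ : P.map (fun ω => ((Y ω, U ω), Z ω)) =
      ((P.map fun ω => (Y ω, Z ω)).prod (P.map U)).map e := by
    rw [← (indepFun_iff_map_prod_eq_prod_map_map (hY.prodMk hZ).aemeasurable hU.aemeasurable).1 h,
      Measure.map_map he ((hY.prodMk hZ).prodMk hU)]
    rfl
  have e₂ : (P.map (fun ω => (Y ω, U ω))).prod (P.map Z) =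
      (((P.map Y).prod (P.map Z)).prod (P.map U)).map e := by
    rw [(indepFun_iff_map_prod_eq_prod_map_map hY.aemeasurable hU.aemeasurable).1 hYU]
    refine Measure.ext_prod₃' fun {s t u} hs ht hu => ?_
    have hpre : e ⁻¹' ((s ×ˢ t) ×ˢ u) = (s ×ˢ u) ×ˢ t := by
      ext x
      simp only [e, mem_preimage, mem_prod]
      tauto
    rw [Measure.map_apply he ((hs.prod ht).prod hu), hpre]
    simp only [Measure.prod_prod]
    ring
  rw [mutualInfo, mutualInfo, e₁, e₂]
  refine (InformationTheory.klDiv_map_le _ _ he).trans ?_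
  -- Both measures carry the same independent factor, the law of `U`, which contributes no
  -- divergence.
  rw [← Measure.compProd_const, ← Measure.compProd_const, InformationTheory.klDiv_compProd_left]

end MutualInformation

/-! ### Independence: regrouping and completion -/

section Independence

variable {Ω : Type*} {mΩ : MeasurableSpace Ω} {P : Measure Ω}

theorem indepFun_prodMk_left [IsProbabilityMeasure P] {S₁ S₂ S₃ : Type*}
    [MeasurableSpace S₁] [MeasurableSpace S₂] [MeasurableSpace S₃]
    {X : Ω → S₁} {Y : Ω → S₂} {U : Ω → S₃}
    (hX : Measurable X) (hY : Measurable Y) (hU : Measurable U)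
    (h : IndepFun X (fun ω => (Y ω, U ω)) P) (h' : IndepFun Y U P) :
    IndepFun (fun ω => (X ω, Y ω)) U P := by
  have hXY : IndepFun X Y P := h.comp measurable_id measurable_fst
  have := Measure.isProbabilityMeasure_map (μ := P) hX.aemeasurable
  have := Measure.isProbabilityMeasure_map (μ := P) hY.aemeasurable
  have := Measure.isProbabilityMeasure_map (μ := P) hU.aemeasurable
  rw [indepFun_iff_map_prod_eq_prod_map_map (by fun_prop) (by fun_prop)] at *
  rw [hXY, ← MeasurableEquiv.prodAssoc.map_measurableEquiv_injective.eq_iff,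
    (measurePreserving_prodAssoc _ _ _).map_eq, ← h', ← h,
    Measure.map_map (MeasurableEquiv.measurable _) (by fun_prop)]
  rfl

/-- Independence survives when the σ-algebra on the left is completed by null sets. -/
theorem indep_eventuallyMeasurableSpace {m₁ m₂ : MeasurableSpace Ω} (h : Indep m₁ m₂ P) :
    Indep (eventuallyMeasurableSpace m₁ (ae P)) m₂ P := by
  rw [Indep_iff] at *
  rintro s t ⟨s', hs', hss'⟩ ht
  rw [measure_congr (hss'.inter (Filter.EventuallyEq.refl _ t)), measure_congr hss', h s' t hs' ht]

end Independence

/-! ### Measurability of solutions of linear Volterra equations -/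

section Volterra

open Filter Topology

variable {Ω : Type*} {m mΩ : MeasurableSpace Ω} {P : Measure Ω}

/-- An almost everywhere limit of functions that are almost everywhere equal to functions measurable
with respect to a σ-algebra `m` has the same property. -/
theorem aestronglyMeasurable_sub_of_tendsto_ae {F : Type*} [NormedAddCommGroup F]
    [CompleteSpace F] {f : ℕ → Ω → F} {g : Ω → F}
    (hf : ∀ n, AEStronglyMeasurable[m] (f n) P)
    (hlim : ∀ᵐ ω ∂P, Tendsto (fun n => f n ω) atTop (𝓝 (g ω))) :
    AEStronglyMeasurable[m] g P := by
  choose h hh hfh using hf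
  -- `limUnder` is total; its arbitrary value where the limit fails to exist matters only on a null
  -- set.
  refine ⟨fun ω => limUnder atTop fun n => h n ω,
    @StronglyMeasurable.limUnder _ _ _ m _ _ _ _ _ _ _ hh, ?_⟩
  filter_upwards [ae_all_iff.2 hfh, hlim] with ω hω hl
  simp only [hω] at hl
  exact hl.limUnder_eq.symm

variable {E F : Type*} [NormedAddCommGroup E] [NormedSpace ℝ E] [NormedAddCommGroup F]
  [NormedSpace ℝ F]

theorem tendsto_floor_mul_div (s : ℝ) :
    Tendsto (fun n : ℕ => (⌊((n : ℝ) + 1) * s⌋ : ℝ) / ((n : ℝ) + 1)) atTop (𝓝 s) := by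
  have h1 : Tendsto (fun n : ℕ => s - 1 / ((n : ℝ) + 1)) atTop (𝓝 s) := by
    simpa using tendsto_const_nhds.sub (tendsto_one_div_add_atTop_nhds_zero_nat (𝕜 := ℝ))
  refine tendsto_of_tendsto_of_tendsto_of_le_of_le h1 tendsto_const_nhds (fun n => ?_) fun n => ?_
  · have hn : (0 : ℝ) < n + 1 := by positivity
    have := Int.lt_floor_add_one (((n : ℝ) + 1) * s)
    simp only
    rw [le_div_iff₀ hn, sub_mul, one_div_mul_cancel hn.ne']
    linarith
  · have hn : (0 : ℝ) < n + 1 := by positivity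
    have := Int.floor_le (((n : ℝ) + 1) * s)
    simp only
    rw [div_le_iff₀ hn]
    linarith

theorem integrableOn_clm_apply {a b : ℝ} {K : ℝ → E →L[ℝ] F} {f : ℝ → E}
    (hK : IntegrableOn K (Icc a b)) (hf : ContinuousOn f (Icc a b)) :
    IntegrableOn (fun s => K s (f s)) (Icc a b) := by
  obtain ⟨M, hM⟩ := isCompact_Icc.exists_bound_of_continuousOn hf
  refine Integrable.mono' (hK.norm.mul_const M) ?_ ?_
  · exact isBoundedBilinearMap_apply.continuous.comp_aestronglyMeasurable
      (hK.aestronglyMeasurable.prodMk (hf.aestronglyMeasurable measurableSet_Icc))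
  · filter_upwards [ae_restrict_mem measurableSet_Icc] with s hs
    exact ((K s).le_opNorm _).trans (by gcongr; exact hM s hs)

/-- Sampling through `c` involves only countably many random vectors, so the integrand is jointly
measurable in `(ω, s)` with `m` on the `ω` side. -/
theorem stronglyMeasurable_integral_clm_apply [FiniteDimensional ℝ E] {K : ℝ → E →L[ℝ] F}
    (hK : StronglyMeasurable K)
    {v : ℤ → Ω → E} (hv : ∀ k, StronglyMeasurable[m] (v k)) {c : ℝ → ℤ} (hc : Measurable c)
    (μ : Measure ℝ) [SFinite μ] :
    StronglyMeasurable[m] (fun ω => ∫ s, K s (v (c s) ω) ∂μ) := by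
  borelize E
  have h1 : Measurable (fun p : Ω × ℤ => v p.2 p.1) :=
    measurable_from_prod_countable_left fun k => (hv k).measurable
  have h2 : Measurable (fun p : Ω × ℝ => v (c p.2) p.1) :=
    h1.comp (measurable_fst.prodMk (hc.comp measurable_snd))
  have h3 : StronglyMeasurable (fun p : Ω × ℝ => K p.2 (v (c p.2) p.1)) :=
    isBoundedBilinearMap_apply.continuous.comp_stronglyMeasurable
      ((hK.comp_measurable measurable_snd).prodMk h2.stronglyMeasurable)
  exact h3.integral_prod_right'

/-- The integral of a process with continuous paths against a deterministic integrable kernel is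
measurable with respect to the (completed) σ-algebra generated by the values of the process. -/
theorem aestronglyMeasurable_setIntegral_of_continuousOn [FiniteDimensional ℝ E]
    [CompleteSpace F] {a b : ℝ} (hab : a ≤ b)
    {K : ℝ → E →L[ℝ] F} (hK : IntegrableOn K (Icc a b)) {x : ℝ → Ω → E}
    (hc : ∀ᵐ ω ∂P, ContinuousOn (fun t => x t ω) (Icc a b))
    (hx : ∀ t ∈ Icc a b, AEStronglyMeasurable[m] (x t) P) :
    AEStronglyMeasurable[m] (fun ω => ∫ s in Icc a b, K s (x s ω)) P := by
  borelize E
  have hx' : ∀ t, ∃ v : Ω → E, StronglyMeasurable[m] v ∧ (t ∈ Icc a b → x t =ᵐ[P] v) := by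
    intro t
    by_cases ht : t ∈ Icc a b
    · obtain ⟨v, hv, hxv⟩ := hx t ht
      exact ⟨v, hv, fun _ => hxv⟩
    · exact ⟨0, stronglyMeasurable_zero, fun h => absurd h ht⟩
  choose v hv hxv using hx'
  obtain ⟨K', hK', hKK'⟩ := hK.aestronglyMeasurable
  -- Grid of mesh `1 / (n + 1)`, clamped to `[a, b]` so that every sample point lies where the path
  -- is continuous and has an `m`-measurable version.
  let q : ℕ → ℤ → ℝ := fun n k => projIcc a b hab ((k : ℝ) / ((n : ℝ) + 1))
  have hq : ∀ n k, q n k ∈ Icc a b := fun n k => Subtype.coe_prop _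
  have hqs : ∀ s ∈ Icc a b,
      Tendsto (fun n : ℕ => q n ⌊((n : ℝ) + 1) * s⌋) atTop (𝓝[Icc a b] s) := by
    intro s hs
    refine tendsto_nhdsWithin_iff.2 ⟨?_, Eventually.of_forall fun n => hq n _⟩
    have := ((continuous_subtype_val.comp (continuous_projIcc (h := hab))).tendsto s).comp
      (tendsto_floor_mul_div s)
    simpa [q, Function.comp_def, projIcc_of_mem hab hs] using this
  let I : ℕ → Ω → F := fun n ω => ∫ s in Icc a b, K' s (v (q n ⌊((n : ℝ) + 1) * s⌋) ω)
  have hI : ∀ n, StronglyMeasurable[m] (I n) := by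
    intro n
    exact stronglyMeasurable_integral_clm_apply (m := m) hK' (fun k => hv (q n k))
      (Int.measurable_floor.comp (measurable_const_mul _)) _
  refine aestronglyMeasurable_sub_of_tendsto_ae (fun n => (hI n).aestronglyMeasurable) ?_
  -- There are countably many grid points, so one null set serves them all.
  have hall : ∀ᵐ ω ∂P, ∀ n k, x (q n k) ω = v (q n k) ω :=
    ae_all_iff.2 fun n => ae_all_iff.2 fun k => hxv _ (hq n k)
  filter_upwards [hall, hc] with ω hω hcω
  obtain ⟨M, hM⟩ := isCompact_Icc.exists_bound_of_continuousOn hcω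
  have hlim : ∫ s in Icc a b, K s (x s ω) = ∫ s in Icc a b, K' s (x s ω) :=
    integral_congr_ae (by filter_upwards [hKK'] with s hs; rw [hs])
  rw [hlim]
  refine tendsto_integral_of_dominated_convergence (fun s => ‖K s‖ * M) (fun n => ?_)
    (hK.norm.mul_const M) (fun n => ?_) ?_
  · refine isBoundedBilinearMap_apply.continuous.comp_aestronglyMeasurable
      (hK'.aestronglyMeasurable.prodMk (StronglyMeasurable.aestronglyMeasurable ?_))
    have : Measurable fun s : ℝ => v (q n ⌊((n : ℝ) + 1) * s⌋) ω :=
      (measurable_of_countable fun k => v (q n k) ω).comp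
        (Int.measurable_floor.comp (measurable_const_mul _))
    exact this.stronglyMeasurable
  · filter_upwards [hKK'] with s hs
    rw [← hs, ← hω]
    exact ((K s).le_opNorm _).trans (by gcongr; exact hM _ (hq _ _))
  · filter_upwards [ae_restrict_mem measurableSet_Icc] with s hs
    simp only [← hω]
    exact ((K' s).continuous.tendsto _).comp ((hcω s hs).tendsto.comp (hqs s hs))

/-- The bound `1 / 2` makes the Picard map a contraction in the sup norm. Its iterates from the
forcing term stay `m`-measurable and converge to `x`; comparing them with `x` directly avoids a
separate uniqueness argument. -/
theorem aestronglyMeasurable_of_volterra_of_small [FiniteDimensional ℝ E] {a b : ℝ}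
    {K : ℝ → E →L[ℝ] E} (hK : IntegrableOn K (Icc a b))
    (hsmall : ∫ s in Icc a b, ‖K s‖ ≤ 1 / 2) {x : ℝ → Ω → E}
    (hc : ∀ᵐ ω ∂P, ContinuousOn (fun t => x t ω) (Icc a b))
    (hx : ∀ t ∈ Icc a b,
      AEStronglyMeasurable[m] (fun ω => x t ω - ∫ s in Icc a t, K s (x s ω)) P)
    {t : ℝ} (ht : t ∈ Icc a b) : AEStronglyMeasurable[m] (x t) P := by
  have := FiniteDimensional.complete ℝ E
  let g : ℝ → Ω → E := fun t ω => x t ω - ∫ s in Icc a t, K s (x s ω)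
  let y : ℕ → ℝ → Ω → E := fun n =>
    Nat.rec g (fun _ z t ω => g t ω + ∫ s in Icc a t, K s (z s ω)) n
  have hy : ∀ n t ω, y (n + 1) t ω = g t ω + ∫ s in Icc a t, K s (y n s ω) := fun _ _ _ => rfl
  have hyc : ∀ᵐ ω ∂P, ∀ n, ContinuousOn (fun t => y n t ω) (Icc a b) := by
    filter_upwards [hc] with ω hω n
    have hg : ContinuousOn (fun t => g t ω) (Icc a b) :=
      hω.sub (intervalIntegral.continuousOn_primitive_Icc (integrableOn_clm_apply hK hω))
    induction n with
    | zero => exact hg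
    | succ n ih =>
      exact hg.add (intervalIntegral.continuousOn_primitive_Icc (integrableOn_clm_apply hK ih))
  have hym : ∀ n, ∀ t ∈ Icc a b, AEStronglyMeasurable[m] (y n t) P := by
    intro n
    induction n with
    | zero => exact hx
    | succ n ih =>
      intro t ht
      have hsub : Icc a t ⊆ Icc a b := Icc_subset_Icc_right ht.2
      refine (hx t ht).add (aestronglyMeasurable_setIntegral_of_continuousOn ht.1
        (hK.mono_set hsub) ?_ fun s hs => ih s (hsub hs))
      filter_upwards [hyc] with ω hω using (hω n).mono hsub
  refine aestronglyMeasurable_sub_of_tendsto_ae (fun n => hym n t ht) ?_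
  filter_upwards [hc, hyc] with ω hω hyω
  obtain ⟨M, hM⟩ := isCompact_Icc.exists_bound_of_continuousOn (hω.sub (hyω 0))
  have key : ∀ n, ∀ t ∈ Icc a b, ‖x t ω - y n t ω‖ ≤ M * (1 / 2) ^ n := by
    intro n
    induction n with
    | zero => simpa using hM
    | succ n ih =>
      intro t ht
      have hsub : Icc a t ⊆ Icc a b := Icc_subset_Icc_right ht.2
      have e : x t ω - y (n + 1) t ω = ∫ s in Icc a t, K s (x s ω - y n s ω) := by
        simp only [map_sub]
        rw [integral_sub ((integrableOn_clm_apply hK hω).mono_set hsub)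
          ((integrableOn_clm_apply hK (hyω n)).mono_set hsub), hy]
        simp only [g]
        abel
      have hMn : 0 ≤ M * (1 / 2) ^ n := (norm_nonneg _).trans (ih t ht)
      rw [e]
      calc ‖∫ s in Icc a t, K s (x s ω - y n s ω)‖
          ≤ ∫ s in Icc a t, ‖K s‖ * (M * (1 / 2) ^ n) := by
            refine norm_integral_le_of_norm_le ((hK.mono_set hsub).norm.mul_const _) ?_
            filter_upwards [ae_restrict_mem measurableSet_Icc] with s hs
            exact ((K s).le_opNorm _).trans (by gcongr; exact ih s (hsub hs))
        _ = (∫ s in Icc a t, ‖K s‖) * (M * (1 / 2) ^ n) := integral_mul_const _ _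
        _ ≤ 1 / 2 * (M * (1 / 2) ^ n) := by
            gcongr
            refine le_trans ?_ hsmall
            exact setIntegral_mono_set hK.norm (Eventually.of_forall fun _ => norm_nonneg _)
              hsub.eventuallyLE
        _ = M * (1 / 2) ^ (n + 1) := by ring
  refine tendsto_iff_norm_sub_tendsto_zero.2 ?_
  refine squeeze_zero (fun _ => norm_nonneg _) (fun n => ?_)
    (by simpa using (tendsto_pow_atTop_nhds_zero_of_lt_one (r := (1 / 2 : ℝ))
      (by norm_num) (by norm_num)).const_mul M)
  rw [norm_sub_rev]
  simpa using key n t ht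

theorem setIntegral_Icc_eq_sub {a s t : ℝ} {f : ℝ → F} (has : a ≤ s) (hst : s ≤ t)
    (hf : IntegrableOn f (Icc a t)) :
    ∫ r in Icc s t, f r = (∫ r in Icc a t, f r) - ∫ r in Icc a s, f r := by
  have h₁ : IntervalIntegrable f volume a s :=
    (intervalIntegrable_iff_integrableOn_Icc_of_le has).2 (hf.mono_set (Icc_subset_Icc_right hst))
  have h₂ : IntervalIntegrable f volume a t :=
    (intervalIntegrable_iff_integrableOn_Icc_of_le (has.trans hst)).2 hf
  simp only [integral_Icc_eq_integral_Ioc]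
  rw [← intervalIntegral.integral_of_le hst, ← intervalIntegral.integral_of_le has,
    ← intervalIntegral.integral_of_le (has.trans hst),
    intervalIntegral.integral_interval_sub_left h₂ h₁]

/-- The solution of a linear Volterra equation with integrable kernel is measurable with respect to
the (completed) σ-algebra generated by the forcing term. -/
theorem aestronglyMeasurable_of_volterra [FiniteDimensional ℝ E] {a b : ℝ}
    {K : ℝ → E →L[ℝ] E} (hK : IntegrableOn K (Icc a b)) {x : ℝ → Ω → E}
    (hc : ∀ᵐ ω ∂P, ContinuousOn (fun t => x t ω) (Icc a b))
    (hx : ∀ t ∈ Icc a b,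
      AEStronglyMeasurable[m] (fun ω => x t ω - ∫ s in Icc a t, K s (x s ω)) P)
    {t : ℝ} (ht : t ∈ Icc a b) : AEStronglyMeasurable[m] (x t) P := by
  have := FiniteDimensional.complete ℝ E
  have huc : UniformContinuousOn (fun t => ∫ s in Icc a t, ‖K s‖) (Icc a b) :=
    isCompact_Icc.uniformContinuousOn_of_continuous
      (intervalIntegral.continuousOn_primitive_Icc hK.norm)
  -- On intervals shorter than `δ` the kernel has mass below `1 / 2`. The induction advances by `δ /
  -- 2` to keep the length strictly below `δ`.
  obtain ⟨δ, hδ, hδK⟩ := Metric.uniformContinuousOn_iff.1 huc (1 / 2) (by norm_num)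
  have key : ∀ k : ℕ, ∀ t ∈ Icc a b, t ≤ a + k * (δ / 2) → AEStronglyMeasurable[m] (x t) P := by
    intro k
    induction k with
    | zero =>
      intro t ht hta
      obtain rfl : t = a := le_antisymm (by simpa using hta) ht.1
      simpa using hx t ht
    | succ k ih =>
      intro t ht htk
      by_cases htk' : t ≤ a + k * (δ / 2)
      · exact ih t ht htk'
      push Not at htk'
      set s := a + k * (δ / 2) with hs
      have has : a ≤ s := by rw [hs]; nlinarith [k.cast_nonneg (α := ℝ)]
      have hsb : s ∈ Icc a b := ⟨has, htk'.le.trans ht.2⟩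
      have hsub : Icc s t ⊆ Icc a b := Icc_subset_Icc has ht.2
      have hsub' : Icc a s ⊆ Icc a b := Icc_subset_Icc_right hsb.2
      refine aestronglyMeasurable_of_volterra_of_small (hK.mono_set hsub) ?_
        (hc.mono fun ω hω => hω.mono hsub) (fun r hr => ?_) (right_mem_Icc.2 htk'.le)
      · rw [setIntegral_Icc_eq_sub has htk'.le (hK.mono_set (Icc_subset_Icc_right ht.2)).norm]
        refine (le_abs_self _).trans (hδK t ht s hsb ?_).le
        rw [Real.dist_eq, abs_of_nonneg (by linarith)]
        push_cast at htk
        linarith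
      -- Restarting at `s` moves the integral over `[a, s]` into the forcing term; it is measurable
      -- by the induction hypothesis.
      · have hI : AEStronglyMeasurable[m] (fun ω => ∫ s in Icc a s, K s (x s ω)) P :=
          aestronglyMeasurable_setIntegral_of_continuousOn has (hK.mono_set hsub')
            (hc.mono fun ω hω => hω.mono hsub') fun r hr => ih r (hsub' hr) hr.2
        refine ((hx r (hsub hr)).add hI).congr ?_
        filter_upwards [hc] with ω hω
        simp only [Pi.add_apply]
        rw [setIntegral_Icc_eq_sub has hr.1 ((integrableOn_clm_apply hK hω).mono_set
          (Icc_subset_Icc_right (hsub hr).2))]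
        abel
  obtain ⟨k, hk⟩ := exists_nat_ge ((t - a) / (δ / 2))
  refine key k t ht ?_
  rw [div_le_iff₀ (by positivity)] at hk
  linarith

end Volterra

/-! ### The linear Gaussian model and the Markov argument -/

section Model

variable {Ω : Type*} {m mΩ : MeasurableSpace Ω} {P : Measure Ω} {nX nW nZ : ℕ}
  {A : ℝ → Matrix (Fin nX) (Fin nX) ℝ}
  {B : ℝ → Matrix (Fin nX) (Fin nW) ℝ} {hB : LocallySqIntegrable B}
  {C : ℝ → Matrix (Fin nZ) (Fin nX) ℝ}
  {SW : Matrix (Fin nW) (Fin nW) ℝ} {SN : Matrix (Fin nZ) (Fin nZ) ℝ}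
  {μ₀ : EuclideanSpace ℝ (Fin nX)} {P₀ : Matrix (Fin nX) (Fin nX) ℝ}
  {W : TestFun nW → Ω → ℝ} {N : TestFun nZ → Ω → ℝ}
  {X : ℝ → Ω → Fin nX → ℝ} {Z : TestFun nZ → Ω → ℝ}

/-- The continuous linear map `v ↦ M v`. -/
noncomputable def mulVecCLM {p n : ℕ} (M : Matrix (Fin p) (Fin n) ℝ) :
    (Fin n → ℝ) →L[ℝ] (Fin p → ℝ) :=
  M.mulVecLin.toContinuousLinearMap

@[simp]
theorem mulVecCLM_apply {p n : ℕ} (M : Matrix (Fin p) (Fin n) ℝ) (v : Fin n → ℝ) :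
    mulVecCLM M v = M *ᵥ v := rfl

theorem integrable_sum_sum_smul {p n : ℕ} {G : Type*} [NormedAddCommGroup G] [NormedSpace ℝ G]
    {μ : Measure ℝ} {M : ℝ → Matrix (Fin p) (Fin n) ℝ} (hM : ∀ i j, Integrable (fun t => M t i j) μ)
    (g : Fin p → Fin n → G) : Integrable (fun t => ∑ i, ∑ j, M t i j • g i j) μ :=
  integrable_finsetSum _ fun i _ => integrable_finsetSum _ fun j _ => (hM i j).smul_const _

theorem integrable_mulVecCLM {p n : ℕ} {μ : Measure ℝ} {M : ℝ → Matrix (Fin p) (Fin n) ℝ}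
    (hM : ∀ i j, Integrable (fun t => M t i j) μ) : Integrable (fun t => mulVecCLM (M t)) μ := by
  have h : (fun t => mulVecCLM (M t)) =
      fun t => ∑ i, ∑ j, M t i j • mulVecCLM (Matrix.single i j (1 : ℝ)) := by
    funext t
    ext1 v
    conv_lhs => rw [Matrix.matrix_eq_sum_single (M t)]
    simp [Matrix.sum_mulVec, ← Matrix.smul_mulVec,
      Matrix.smul_single]
  rw [h]
  exact integrable_sum_sum_smul hM _

/-- White noise increments over disjoint time intervals are independent. -/
theorem IsWhiteNoise.indepFun_increments {S : Matrix (Fin nW) (Fin nW) ℝ}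
    (hW : IsWhiteNoise P S W) (hB : LocallySqIntegrable B) (T T' : ℝ) :
    IndepFun (fun ω (p : Fin nX × Icc 0 T) => W (rowUpTo B hB p.1 p.2) ω)
      (fun ω (p : Fin nX × Icc T T') =>
        W (rowUpTo B hB p.1 p.2) ω - W (rowUpTo B hB p.1 T) ω) P := by
  classical
  have := hW.gaussian.isProbabilityMeasure
  have hL (f) : MemLp (W f) 2 P := (hW.gaussian.hasGaussianLaw_eval f).memLp_two
  refine IsGaussianProcess.indepFun_of_covariance_eq_zero
    (X := fun (p : Fin nX × Icc 0 T) ω => W (rowUpTo B hB p.1 p.2) ω)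
    (Y := fun (p : Fin nX × Icc T T') ω =>
        W (rowUpTo B hB p.1 p.2) ω - W (rowUpTo B hB p.1 T) ω) ?_
    (fun s => (hW.measurable _).aemeasurable)
    (fun s => ((hW.measurable _).sub (hW.measurable _)).aemeasurable) ?_
  · refine hW.gaussian.of_isGaussianProcess ?_
    rintro (p | p)
    · exact ⟨{rowUpTo B hB p.1 p.2},
        ContinuousLinearMap.proj (R := ℝ) ⟨rowUpTo B hB p.1 p.2, Finset.mem_singleton_self _⟩,
        fun ω => rfl⟩
    · exact ⟨{rowUpTo B hB p.1 p.2, rowUpTo B hB p.1 T},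
        ContinuousLinearMap.proj (R := ℝ) ⟨rowUpTo B hB p.1 p.2, by simp⟩ -
          ContinuousLinearMap.proj (R := ℝ) ⟨rowUpTo B hB p.1 T, by simp⟩, fun ω => rfl⟩
  · rintro ⟨i, r, hr⟩ ⟨j, t, ht⟩
    have hcov (f g) : cov[W f, W g; P] = ∫ t, f.1 t ⬝ᵥ (S *ᵥ g.1 t) := by
      rw [covariance_eq_sub (hL f) (hL g), hW.mean_zero f, zero_mul, sub_zero]
      exact hW.covariance f g
    refine (covariance_sub_right (hL _) (hL _) (hL _)).trans ?_
    rw [hcov, hcov, sub_eq_zero]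
    congr 1
    funext s
    -- The first test function lives on `[0, r]` with `r ≤ T ≤ t`; there the cutoffs at `t` and at
    -- `T` are both `1`, so the two covariances agree.
    by_cases hs : s ∈ Icc 0 r
    · have h₁ : s ∈ Icc 0 t := ⟨hs.1, hs.2.trans (hr.2.trans ht.1)⟩
      have h₂ : s ∈ Icc 0 T := ⟨hs.1, hs.2.trans hr.2⟩
      simp [rowUpTo, h₁, h₂]
    · simp [rowUpTo, indicator_of_notMem hs]

theorem integrableOn_mulVecCLM_of_locallyIntegrableOn
    (hA : ∀ i j, LocallyIntegrableOn (fun t => A t i j) (Ici 0)) {a b : ℝ} (ha : 0 ≤ a) :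
    IntegrableOn (fun t => mulVecCLM (A t)) (Icc a b) :=
  integrable_mulVecCLM fun i j => (hA i j).integrableOn_compact_subset
    (fun _ hs => ha.trans hs.1) isCompact_Icc

theorem IsLinearGaussianModel.continuousOn_Icc
    (h : IsLinearGaussianModel P A B hB C SW SN μ₀ P₀ W N X Z) {a : ℝ} (b : ℝ) (ha : 0 ≤ a) :
    ∀ᵐ ω ∂P, ContinuousOn (fun t => X t ω) (Icc a b) :=
  h.continuous_X.mono fun _ hω => hω.mono fun _ hs => ha.trans hs.1

/-- The state equation, started at time `a`. -/
theorem IsLinearGaussianModel.state_eq_from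
    (h : IsLinearGaussianModel P A B hB C SW SN μ₀ P₀ W N X Z)
    (hA : ∀ i j, LocallyIntegrableOn (fun t => A t i j) (Ici 0)) {a t : ℝ} (ha : 0 ≤ a)
    (hat : a ≤ t) :
    (fun ω => X t ω - ∫ s in Icc a t, mulVecCLM (A s) (X s ω)) =ᵐ[P]
      fun ω => X a ω + fun i => W (rowUpTo B hB i t) ω - W (rowUpTo B hB i a) ω := by
  filter_upwards [h.state_eq t (ha.trans hat), h.state_eq a ha, h.continuousOn_Icc t le_rfl]
    with ω ht hω hc
  have hint : IntegrableOn (fun s => mulVecCLM (A s) (X s ω)) (Icc 0 t) :=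
    integrableOn_clm_apply (integrableOn_mulVecCLM_of_locallyIntegrableOn hA le_rfl) hc
  have hcoord (i : Fin nX) {u : ℝ} (hu : 0 ≤ u) (hut : u ≤ t) :
      (∫ s in Icc 0 u, mulVecCLM (A s) (X s ω)) i = ∫ s in (0 : ℝ)..u, (A s *ᵥ X s ω) i := by
    rw [eval_integral (fun j => (hint.mono_set (Icc_subset_Icc_right hut)).eval j),
      integral_Icc_eq_integral_Ioc, ← intervalIntegral.integral_of_le hu]
    rfl
  rw [setIntegral_Icc_eq_sub ha hat hint]
  funext i
  simp only [Pi.sub_apply, Pi.add_apply]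
  rw [hcoord i (ha.trans hat) le_rfl, hcoord i ha hat, ht i, hω i]
  ring

/-- The state on `[a, b]` is a function of the state at time `a` and the driving noise. -/
theorem IsLinearGaussianModel.aestronglyMeasurable_state
    (h : IsLinearGaussianModel P A B hB C SW SN μ₀ P₀ W N X Z)
    (hA : ∀ i j, LocallyIntegrableOn (fun t => A t i j) (Ici 0))
    {a b : ℝ} (ha : 0 ≤ a) (hXa : Measurable[m] (X a))
    (hW : ∀ i, ∀ t ∈ Icc a b,
      AEStronglyMeasurable[m] (fun ω => W (rowUpTo B hB i t) ω - W (rowUpTo B hB i a) ω) P)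
    {t : ℝ} (ht : t ∈ Icc a b) : AEStronglyMeasurable[m] (X t) P := by
  refine aestronglyMeasurable_of_volterra
    (integrableOn_mulVecCLM_of_locallyIntegrableOn hA ha) (h.continuousOn_Icc b ha)
    (fun s hs => ?_) ht
  refine AEStronglyMeasurable.congr ?_ (h.state_eq_from hA ha hs.1).symm
  refine hXa.stronglyMeasurable.aestronglyMeasurable.add ?_
  choose v hv hWv using fun i => hW i s hs
  refine ⟨fun ω i => v i ω,
    (@measurable_pi_lambda _ _ _ m _ _ fun i => (hv i).measurable).stronglyMeasurable, ?_⟩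
  filter_upwards [ae_all_iff.2 hWv] with ω hω
  exact funext hω

/-- The measurement history up to time `τ` is a function of the state up to time `τ` and the
measurement noise. -/
theorem IsLinearGaussianModel.aestronglyMeasurable_measurement
    (h : IsLinearGaussianModel P A B hB C SW SN μ₀ P₀ W N X Z)
    (hC : LocallySqIntegrable C) {τ : ℝ} (hτ : 0 ≤ τ)
    (hX : ∀ t ∈ Icc 0 τ, AEStronglyMeasurable[m] (X t) P) {φ : TestFun nZ}
    (hφ : ∀ t, t ∉ Icc 0 τ → φ.1 t = 0) (hN : Measurable[m] (N φ)) :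
    AEStronglyMeasurable[m] (Z φ) P := by
  -- The row `φ' C` as a one-row matrix, integrable on `[0, τ]` as a product of square-integrable
  -- factors.
  let K : ℝ → (Fin nX → ℝ) →L[ℝ] (Fin 1 → ℝ) :=
    fun t => mulVecCLM (Matrix.of fun _ : Fin 1 => φ.1 t ᵥ* C t)
  have hK : IntegrableOn K (Icc 0 τ) := by
    refine integrable_mulVecCLM fun _ j => ?_
    simp only [Matrix.of_apply, Matrix.vecMul, dotProduct]
    exact integrable_finsetSum _ fun i _ =>
      ((φ.2.1.eval i).restrict _).integrable_mul (hC i j τ)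
  have hI := aestronglyMeasurable_setIntegral_of_continuousOn hτ hK
    (h.continuousOn_Icc τ le_rfl) hX
  refine AEStronglyMeasurable.congr (((continuous_apply (0 : Fin 1)).comp_aestronglyMeasurable
    hI).add hN.stronglyMeasurable.aestronglyMeasurable) ?_
  filter_upwards [h.measurement_eq φ, h.continuousOn_Icc τ le_rfl] with ω hω hc
  have hint := integrableOn_clm_apply hK hc
  simp only [Pi.add_apply]
  have e : ∫ t, φ.1 t ⬝ᵥ (C t *ᵥ X t ω) = ∫ t in Icc 0 τ, φ.1 t ⬝ᵥ (C t *ᵥ X t ω) :=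
    (setIntegral_eq_integral_of_forall_compl_eq_zero
      fun t ht => by rw [hφ t ht, zero_dotProduct]).symm
  rw [hω, e, eval_integral (fun j => hint.eval j)]
  simp [K, Matrix.mulVec, Matrix.dotProduct_mulVec]

/-- In the completed σ-algebra each coordinate is genuinely measurable, hence so is an uncountable
family such as the measurement history. -/
theorem measurable_eventuallyMeasurableSpace_of_aestronglyMeasurable {E : Type*}
    [NormedAddCommGroup E] [MeasurableSpace E] [BorelSpace E] {f : Ω → E}
    (hf : AEStronglyMeasurable[m] f P) : Measurable[eventuallyMeasurableSpace m (ae P)] f := by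
  obtain ⟨g, hg, hfg⟩ := hf
  exact (hg.measurable.eventuallyMeasurable (l := ae P)).congr hfg

/-- The noise increments after time `T` are independent of the initial state, the noise up to time
`T` and the measurement noise. -/
theorem IsLinearGaussianModel.indepFun_past_increments [IsProbabilityMeasure P]
    (h : IsLinearGaussianModel P A B hB C SW SN μ₀ P₀ W N X Z) (T T' : ℝ) :
    IndepFun (fun ω => ((fun φ => N φ ω), X 0 ω,
        fun p : Fin nX × Icc 0 T => W (rowUpTo B hB p.1 p.2) ω))
      (fun ω (p : Fin nX × Icc T T') =>
        W (rowUpTo B hB p.1 p.2) ω - W (rowUpTo B hB p.1 T) ω) P := by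
  have hX := h.measurable_X 0 le_rfl
  have hN : Measurable fun ω φ => N φ ω := measurable_pi_lambda _ h.whiteNoise_N.measurable
  have hWp : Measurable fun ω (p : Fin nX × Icc 0 T) => W (rowUpTo B hB p.1 p.2) ω :=
    measurable_pi_lambda _ fun p => h.whiteNoise_W.measurable _
  have hU : Measurable fun ω (p : Fin nX × Icc T T') =>
      W (rowUpTo B hB p.1 p.2) ω - W (rowUpTo B hB p.1 T) ω :=
    measurable_pi_lambda _ fun p => (h.whiteNoise_W.measurable _).sub (h.whiteNoise_W.measurable _)
  let past : (TestFun nW → ℝ) → Fin nX × Icc 0 T → ℝ := fun w p => w (rowUpTo B hB p.1 p.2)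
  let incr : (TestFun nW → ℝ) → Fin nX × Icc T T' → ℝ :=
    fun w p => w (rowUpTo B hB p.1 p.2) - w (rowUpTo B hB p.1 T)
  have hpast : Measurable past := measurable_pi_lambda _ fun p => measurable_pi_apply _
  have hincr : Measurable incr :=
    measurable_pi_lambda _ fun p => (measurable_pi_apply _).sub (measurable_pi_apply _)
  -- First `X 0` joins the noise past, being independent of all of `W`; then `N` joins, being
  -- independent of `(X 0, W)`.
  have h₁ := indepFun_prodMk_left hX hWp hU (h.indep_W.comp measurable_id (hpast.prodMk hincr))
    (h.whiteNoise_W.indepFun_increments hB T T')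
  have hφ : Measurable fun q : (Fin nX → ℝ) × (TestFun nW → ℝ) => ((q.1, past q.2), incr q.2) :=
    (measurable_fst.prodMk (hpast.comp measurable_snd)).prodMk (hincr.comp measurable_snd)
  exact indepFun_prodMk_left hN (hX.prodMk hWp) hU (h.indep_N.symm.comp measurable_id hφ) h₁

/-- The noise increments after time `T` are independent of the state at time `T` and of the
measurement history up to time `τ ≤ T`. -/
theorem IsLinearGaussianModel.indepFun_state_history_increments [IsProbabilityMeasure P]
    (h : IsLinearGaussianModel P A B hB C SW SN μ₀ P₀ W N X Z)
    (hA : ∀ i j, LocallyIntegrableOn (fun t => A t i j) (Ici 0)) (hC : LocallySqIntegrable C)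
    {τ T : ℝ} (hτ : 0 ≤ τ) (hτT : τ ≤ T) (T' : ℝ) :
    IndepFun (fun ω => (X T ω, historyOn Z 0 τ ω))
      (fun ω (p : Fin nX × Icc T T') =>
        W (rowUpTo B hB p.1 p.2) ω - W (rowUpTo B hB p.1 T) ω) P := by
  have hT := hτ.trans hτT
  let V : Ω → (TestFun nZ → ℝ) × (Fin nX → ℝ) × (Fin nX × Icc 0 T → ℝ) :=
    fun ω => ((fun φ => N φ ω), X 0 ω, fun p => W (rowUpTo B hB p.1 p.2) ω)
  let m₁ : MeasurableSpace Ω := MeasurableSpace.comap V inferInstance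
  have hV : Measurable[m₁] V := comap_measurable V
  have hX₀ : Measurable[m₁] (X 0) := measurable_fst.comp (measurable_snd.comp hV)
  have hN (φ) : Measurable[m₁] (N φ) := (measurable_pi_apply φ).comp (measurable_fst.comp hV)
  have hW (i : Fin nX) (t : ℝ) (ht : t ∈ Icc 0 T) : Measurable[m₁] (W (rowUpTo B hB i t)) :=
    (measurable_pi_apply (i, (⟨t, ht⟩ : Icc 0 T))).comp
      (measurable_snd.comp (measurable_snd.comp hV))
  have hX (t : ℝ) (ht : t ∈ Icc 0 T) : AEStronglyMeasurable[m₁] (X t) P :=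
    h.aestronglyMeasurable_state (m := m₁) hA le_rfl hX₀
      (fun i s hs => ((hW i s hs).sub (hW i 0 ⟨le_rfl, hT⟩)).stronglyMeasurable.aestronglyMeasurable)
      ht
  have hZ (φ : TestFun nZ) (hφ : ∀ t, t ∉ Icc 0 τ → φ.1 t = 0) :
      AEStronglyMeasurable[m₁] (Z φ) P :=
    h.aestronglyMeasurable_measurement (m := m₁) hC hτ
      (fun t ht => hX t ⟨ht.1, ht.2.trans hτT⟩) hφ (hN φ)
  have hXZ : Measurable[eventuallyMeasurableSpace m₁ (ae P)]
      fun ω => (X T ω, historyOn Z 0 τ ω) :=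
    (measurable_eventuallyMeasurableSpace_of_aestronglyMeasurable
      (hX T ⟨hT, le_rfl⟩)).prodMk
      (@measurable_pi_lambda _ _ _ (eventuallyMeasurableSpace m₁ (ae P)) _ _ fun φ =>
        measurable_eventuallyMeasurableSpace_of_aestronglyMeasurable (hZ φ.1 φ.2))
  exact indep_of_indep_of_le_left
    (indep_eventuallyMeasurableSpace (h.indepFun_past_increments T T')) hXZ.comap_le

/-- The information that the measurement history carries on the state path over `[T, T']` is the
information it carries on the state at the initial time `T`. -/
theorem IsLinearGaussianModel.mutualInfo_pathOn [IsProbabilityMeasure P]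
    (h : IsLinearGaussianModel P A B hB C SW SN μ₀ P₀ W N X Z)
    (hA : ∀ i j, LocallyIntegrableOn (fun t => A t i j) (Ici 0)) (hC : LocallySqIntegrable C)
    {τ T T' : ℝ} (hτ : 0 ≤ τ) (hτT : τ ≤ T) (hT' : T ≤ T') :
    mutualInfo P (pathOn X T T') (historyOn Z 0 τ) = mutualInfo P (X T) (historyOn Z 0 τ) := by
  have hT := hτ.trans hτT
  have hXT := h.measurable_X T hT
  have hZ : Measurable (historyOn Z 0 τ) := measurable_pi_lambda _ fun φ => h.measurable_Z φ.1
  have hX : Measurable (pathOn X T T') :=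
    measurable_pi_lambda _ fun t => h.measurable_X t (hT.trans t.2.1)
  let U : Ω → Fin nX × Icc T T' → ℝ :=
    fun ω p => W (rowUpTo B hB p.1 p.2) ω - W (rowUpTo B hB p.1 T) ω
  have hU : Measurable U :=
    measurable_pi_lambda _ fun p => (h.whiteNoise_W.measurable _).sub (h.whiteNoise_W.measurable _)
  have hXU := hXT.prodMk hU
  refine le_antisymm ?_ (mutualInfo_comp_left_le hX hZ
    (measurable_pi_apply (⟨T, le_rfl, hT'⟩ : Icc T T')))
  -- Doob–Dynkin factorization, one `t` at a time: the product σ-algebra on paths requires no joint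
  -- measurability in `t`.
  have hF (t : Icc T T') : ∃ F : (Fin nX → ℝ) × (Fin nX × Icc T T' → ℝ) → Fin nX → ℝ,
      Measurable F ∧ X t =ᵐ[P] fun ω => F (X T ω, U ω) := by
    let m₂ : MeasurableSpace Ω := MeasurableSpace.comap (fun ω => (X T ω, U ω)) inferInstance
    have hm₂ : Measurable[m₂] fun ω => (X T ω, U ω) := comap_measurable _
    obtain ⟨v, hv, hXv⟩ := h.aestronglyMeasurable_state (m := m₂) hA hT (measurable_fst.comp hm₂)
      (fun i s hs => ((measurable_pi_apply (i, (⟨s, hs⟩ : Icc T T'))).comp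
        (measurable_snd.comp hm₂)).stronglyMeasurable.aestronglyMeasurable) t.2
    obtain ⟨F, hF, rfl⟩ := hv.exists_eq_measurable_comp
    exact ⟨F, hF.measurable, hXv⟩
  choose F hF hXF using hF
  have hFm : Measurable fun u t => F t u := measurable_pi_lambda _ hF
  calc mutualInfo P (pathOn X T T') (historyOn Z 0 τ)
      = mutualInfo P (fun ω t => F t (X T ω, U ω)) (historyOn Z 0 τ) :=
        mutualInfo_congr_of_forall_ae_eq hX (hFm.comp hXU) hZ hXF
    _ ≤ mutualInfo P (fun ω => (X T ω, U ω)) (historyOn Z 0 τ) :=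
        mutualInfo_comp_left_le hXU hZ hFm
    _ ≤ mutualInfo P (X T) (historyOn Z 0 τ) :=
        mutualInfo_prodMk_le_of_indepFun hXT hZ hU
          (h.indepFun_state_history_increments hA hC hτ hτT T')

end Model

end LinearForecast

theorem mainTheorem2 {Ω : Type*} [MeasurableSpace Ω] (P : Measure Ω) [IsProbabilityMeasure P]
    {nX nW nZ : ℕ}
    (A : ℝ → Matrix (Fin nX) (Fin nX) ℝ)
    (hA : ∀ i j, LocallyIntegrableOn (fun t => A t i j) (Ici 0))
    (B : ℝ → Matrix (Fin nX) (Fin nW) ℝ) (hB : LinearForecast.LocallySqIntegrable B)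
    (C : ℝ → Matrix (Fin nZ) (Fin nX) ℝ) (hC : LinearForecast.LocallySqIntegrable C)
    (SW : Matrix (Fin nW) (Fin nW) ℝ) (hSW : SW.PosDef)
    (SN : Matrix (Fin nZ) (Fin nZ) ℝ) (hSN : SN.PosDef)
    (μ₀ : EuclideanSpace ℝ (Fin nX)) (P₀ : Matrix (Fin nX) (Fin nX) ℝ) (hP₀ : P₀.PosDef)
    (W : LinearForecast.TestFun nW → Ω → ℝ) (N : LinearForecast.TestFun nZ → Ω → ℝ)
    (X : ℝ → Ω → Fin nX → ℝ) (Z : LinearForecast.TestFun nZ → Ω → ℝ)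
    (hmodel : LinearForecast.IsLinearGaussianModel P A B hB C SW SN μ₀ P₀ W N X Z)
    (τ Ti Tf : ℝ) (hτ : 0 ≤ τ) (hτTi : τ ≤ Ti) (hTiTf : Ti ≤ Tf)
    (MV : ℝ → Matrix (Fin nX) (Fin nX) ℝ) (hMV : ∀ t ∈ Icc Ti Tf, MV t = 1) :
    LinearForecast.mutualInfo P
        (LinearForecast.pathOn (LinearForecast.verification MV X) Ti Tf)
        (LinearForecast.historyOn Z 0 τ) =
      LinearForecast.mutualInfo P (LinearForecast.verification MV X Ti)
        (LinearForecast.historyOn Z 0 τ) ∧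
    LinearForecast.mutualInfo P (LinearForecast.pathOn X Ti Tf)
        (LinearForecast.historyOn Z 0 τ) =
      LinearForecast.mutualInfo P (X Ti) (LinearForecast.historyOn Z 0 τ) := by

  have hV (t : ℝ) (ht : t ∈ Icc Ti Tf) : LinearForecast.verification MV X t = X t := by
    funext ω
    simp [LinearForecast.verification, hMV t ht]
  have hpath : LinearForecast.pathOn (LinearForecast.verification MV X) Ti Tf =
      LinearForecast.pathOn X Ti Tf := by
    funext ω t
    simp only [LinearForecast.pathOn, hV t t.2]
  have h := hmodel.mutualInfo_pathOn hA hC hτ hτTi hTiTf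
  rw [hpath, hV Ti (left_mem_Icc.2 hTiTf)]
  exact ⟨h, h⟩
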